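/- Let $\mathbb D$ be the open unit disc and let $A^1$ be the Bergman space of all analytic functions $f$ on $\mathbb D$ with $\|f\|_{A^1}=\int_{\mathbb D}|f(z)|\,dA(z)<\infty$, where $dA=dx\,dy/\pi$. For a Borel probability measure $\mu$ on $[0,1)$ put $$\Gamma_\mu(f)(z)=\int_{[0,1)} f\!\left(\frac{t}{1+(t-1)z}\right)\frac{1}{1+(t-1)z}\,d\mu(t),\qquad z\in\mathbb D .$$ Suppose that $\Gamma_\mu$ is bounded on $A^1$, i.e. for every $f\in A^1$ the integral converges absolutely for every $z\in\mathbb D$, the function $\Gamma_\mu(f)$ belongs to $A^1$, and $\|\Gamma_\mu(f)\|_{A^1}\le C\|f\|_{A^1}$ with a constant $C$ independent of $f$. Then: (i) $\Gamma_\mu$ is compact on $A^1$ if and only if $\mu=\delta_0$, the Dirac point mass at $0$; (ii) whether or not $\Gamma_\mu$ is compact, it is completely continuous on $A^1$: if $f_n\to f$ weakly in $A^1$, then $\Gamma_\mu(f_n)\to\Gamma_\mu(f)$ in the norm of $A^1$. In particular $\Gamma_\mu$ maps weakly null sequences to norm-null sequences. -/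

import Mathlib

open MeasureTheory Filter Topology

noncomputable section

namespace BergmanHilbert

/-- The open unit disc of the complex plane. -/
def disc : Set ℂ := Metric.ball 0 1

/-- The functions that make up the Bergman space `A¹`: holomorphic on the unit disc and integrable
there with respect to area. A function on the disc is represented by its extension by zero to `ℂ`,
so that two elements are equal exactly when they agree on the disc. -/
def bergmanSubmodule : Submodule ℂ (ℂ → ℂ) where
  carrier := {f | DifferentiableOn ℂ f disc ∧ IntegrableOn f disc volume ∧ ∀ z ∉ disc, f z = 0}
  zero_mem' := ⟨differentiableOn_const 0, integrableOn_zero, fun _ _ => rfl⟩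
  add_mem' := by
    rintro f g ⟨hf, hf', hf''⟩ ⟨hg, hg', hg''⟩
    exact ⟨hf.add hg, hf'.add hg', fun z hz => by simp [hf'' z hz, hg'' z hz]⟩
  smul_mem' := by
    rintro c f ⟨hf, hf', hf''⟩
    exact ⟨hf.const_smul c, hf'.smul c, fun z hz => by simp [hf'' z hz]⟩

/-- The Bergman space `A¹` of the unit disc. It is a type of its own, so that its topology is the
one of the norm below and not the topology of pointwise convergence. -/
def A1 : Type := bergmanSubmodule

namespace A1

instance : AddCommGroup A1 := inferInstanceAs (AddCommGroup bergmanSubmodule)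

instance : Module ℂ A1 := inferInstanceAs (Module ℂ bergmanSubmodule)

/-- The element of `A¹` given by a function that satisfies the defining conditions. -/
def mk (f : ℂ → ℂ) (hf : f ∈ bergmanSubmodule) : A1 := ⟨f, hf⟩

instance : CoeFun A1 (fun _ => ℂ → ℂ) := ⟨fun f => f.1⟩

/-- The norm `‖f‖ = ∫_𝔻 |f| dA`, where `dA = dx dy / π`. -/
instance : Norm A1 := ⟨fun f => Real.pi⁻¹ * ∫ z in disc, ‖f z‖⟩

theorem norm_def (f : A1) : ‖f‖ = Real.pi⁻¹ * ∫ z in disc, ‖f z‖ := rfl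

@[ext] theorem ext {f g : A1} (h : ∀ z ∈ disc, f z = g z) : f = g := by
  apply Subtype.ext
  funext z
  by_cases hz : z ∈ disc
  · exact h z hz
  · exact (f.2.2.2 z hz).trans (g.2.2.2 z hz).symm

@[simp] theorem add_apply (f g : A1) (z : ℂ) : (f + g) z = f z + g z := rfl

@[simp] theorem neg_apply (f : A1) (z : ℂ) : (-f) z = -f z := rfl

@[simp] theorem zero_apply (z : ℂ) : (0 : A1) z = 0 := rfl

@[simp] theorem smul_apply (c : ℂ) (f : A1) (z : ℂ) : (c • f) z = c * f z := rfl

theorem eq_zero_of_norm_eq_zero (f : A1) (h : ‖f‖ = 0) : f = 0 := by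
  have h1 : ∫ z in disc, ‖f z‖ = 0 := by
    rw [norm_def] at h
    exact (mul_eq_zero.mp h).resolve_left (inv_ne_zero Real.pi_ne_zero)
  have h2 : (fun z => ‖f z‖) =ᵐ[volume.restrict disc] 0 :=
    (setIntegral_eq_zero_iff_of_nonneg_ae (ae_of_all _ fun z => norm_nonneg _)
      f.2.2.1.norm).mp h1
  have h3 : Set.EqOn (fun z => ‖f z‖) (fun _ => (0 : ℝ)) disc :=
    Measure.eqOn_open_of_ae_eq h2 Metric.isOpen_ball f.2.1.continuousOn.norm continuousOn_const
  ext z hz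
  exact norm_eq_zero.mp (h3 hz)

theorem normCore : NormedSpace.Core ℂ A1 where
  norm_nonneg f := mul_nonneg (inv_nonneg.mpr Real.pi_pos.le)
    (integral_nonneg fun z => norm_nonneg _)
  norm_smul c f := by
    simp only [norm_def, smul_apply, norm_mul, integral_const_mul]
    ring
  norm_triangle f g := by
    simp only [norm_def, add_apply]
    rw [← mul_add, ← integral_add f.2.2.1.norm g.2.2.1.norm]
    refine mul_le_mul_of_nonneg_left ?_ (inv_nonneg.mpr Real.pi_pos.le)
    exact integral_mono (f.2.2.1.add g.2.2.1).norm (f.2.2.1.norm.add g.2.2.1.norm)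
      fun z => norm_add_le _ _
  norm_eq_zero_iff f := ⟨eq_zero_of_norm_eq_zero f, fun h => by simp [h, norm_def]⟩

instance : NormedAddCommGroup A1 := NormedAddCommGroup.ofCore normCore

instance : NormedSpace ℂ A1 := NormedSpace.ofCore normCore

end A1

/-- The function `φ_t(z) = t / (1 + (t - 1) z)`. -/
def phi (t : ℝ) (z : ℂ) : ℂ := t / (1 + (t - 1) * z)

/-- The weight `w_t(z) = 1 / (1 + (t - 1) z)`. -/
def weight (t : ℝ) (z : ℂ) : ℂ := 1 / (1 + (t - 1) * z)

/-- The function `Γ_μ(f)(z) = ∫_{[0,1)} f(φ_t(z)) w_t(z) dμ(t)` on the unit disc (extended by zero),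
for a Borel measure `μ` on `[0,1)`. -/
def gamma (μ : Measure (Set.Ico (0 : ℝ) 1)) (f : ℂ → ℂ) : ℂ → ℂ :=
  disc.indicator fun z => ∫ t, f (phi t z) * weight t z ∂μ

/-- `Γ_μ` is bounded on `A¹`: for each `f` in `A¹` the defining integral converges absolutely at
every point of the disc, the function `Γ_μ(f)` belongs to `A¹`, and its norm is at most a constant
times the norm of `f`. -/
structure GammaBounded (μ : Measure (Set.Ico (0 : ℝ) 1)) : Prop where
  integrable : ∀ f : A1, ∀ z ∈ disc,
    Integrable (fun t : Set.Ico (0 : ℝ) 1 => f (phi t z) * weight t z) μ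
  mem : ∀ f : A1, gamma μ f ∈ bergmanSubmodule
  bound : ∃ C : ℝ, ∀ f : A1, ‖A1.mk (gamma μ f) (mem f)‖ ≤ C * ‖f‖

/-- `Γ_μ` as a linear operator on `A¹`. -/
def gammaLinear (μ : Measure (Set.Ico (0 : ℝ) 1)) (h : GammaBounded μ) : A1 →ₗ[ℂ] A1 where
  toFun f := A1.mk (gamma μ f) (h.mem f)
  map_add' f g := by
    ext z hz
    change gamma μ (f + g : A1) z = gamma μ f z + gamma μ g z
    simp only [gamma, Set.indicator_of_mem hz, A1.add_apply, add_mul]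
    exact integral_add (h.integrable f z hz) (h.integrable g z hz)
  map_smul' c f := by
    ext z hz
    change gamma μ (c • f : A1) z = c * gamma μ f z
    simp only [gamma, Set.indicator_of_mem hz, A1.smul_apply, mul_assoc]
    exact integral_const_mul c _

/-- `Γ_μ` as a bounded linear operator on `A¹`. -/
def gammaOp (μ : Measure (Set.Ico (0 : ℝ) 1)) (h : GammaBounded μ) : A1 →L[ℂ] A1 where
  toLinearMap := gammaLinear μ h
  cont := AddMonoidHomClass.continuous_of_bound (gammaLinear μ h) h.bound.choose
    h.bound.choose_spec

/-- A bounded operator is completely continuous if it maps weakly convergent sequences to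
norm-convergent sequences (necessarily with the image of the weak limit as limit). -/
def CompletelyContinuous {X Y : Type*} [NormedAddCommGroup X] [NormedSpace ℂ X]
    [NormedAddCommGroup Y] [NormedSpace ℂ Y] (T : X →L[ℂ] Y) : Prop :=
  ∀ (u : ℕ → X) (x : X),
    Tendsto (fun n => toWeakSpace ℂ X (u n)) atTop (𝓝 (toWeakSpace ℂ X x)) →
      Tendsto (fun n => T (u n)) atTop (𝓝 (T x))

end BergmanHilbert

end

namespace BergmanHilbert

/-! Complete continuity is a property of the space alone: `A1` has the Schur property
(`tendsto_norm_zero_of_forall_tendsto`), so every bounded operator on it is completely continuous.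
The proof is a gliding hump. A weakly null sequence is bounded, tends to zero pointwise and is
uniformly bounded on compact subsets of the disc, so its mass on each smaller disc vanishes. If the
norms did not tend to zero, a subsequence would live, up to small errors, on disjoint annuli.
Integration against a function that on each annulus cancels the phase of the corresponding term is a
bounded functional that does not tend to zero along the subsequence.

Compactness is tested on `f_a(z) = (1 - z)^(-a)` as `a → 2`. Since `1 - φ_t(z) = (1 - t)(1 - z) / (1
+ (t - 1)z)`, the integrand of `Γ_μ(f_a)` is `f_a(z)` times a factor with real part at least `t/2`,
so `|Γ_μ(f_a)| ≥ c |f_a|` with `c = ∫ t/2 dμ`, positive unless `μ = δ_0`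
(`mul_norm_testA1_le_norm_gammaOp`, `integral_pos_of_ne_dirac`). The functions `(2 - a) f_a` are
bounded in norm, yet keep a fixed amount of mass in every neighbourhood of `1`. A norm limit of
their images would have mass at least `2c` near `1` at every scale, which no integrable function
has. For `μ = δ_0` the operator is `f ↦ f(0) / (1 - z)`, of rank one. -/

theorem isOpen_disc : IsOpen disc := Metric.isOpen_ball

theorem measurableSet_disc : MeasurableSet disc := isOpen_disc.measurableSet

theorem mem_disc {z : ℂ} : z ∈ disc ↔ ‖z‖ < 1 := by simp [disc]

/-! ### Area mean value property and point evaluations -/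

/-- The area mean value property on a closed disc. -/
theorem integral_ball_eq_of_differentiableOn {g : ℂ → ℂ} {c : ℂ} {R : ℝ} (hR : 0 < R)
    (hg : ∀ z ∈ Metric.closedBall c R, DifferentiableAt ℂ g z) :
    ∫ w in Metric.ball c R, g w = (Real.pi * R ^ 2 : ℝ) * g c := by
  have hcirc : ∀ r ∈ Set.Ioo 0 R, ∫ θ in Set.Ioo (-Real.pi) Real.pi,
      g (c + r * (Real.cos θ + Real.sin θ * Complex.I)) = (2 * Real.pi : ℝ) * g c := by
    intro r hr
    have h1 : Real.circleAverage g c r = g c := by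
      apply circleAverage_of_differentiable_on_off_countable (s := ∅) Set.countable_empty
      · intro z hz
        refine (hg z ?_).continuousAt.continuousWithinAt
        rw [abs_of_pos hr.1] at hz
        exact Metric.closedBall_subset_closedBall hr.2.le hz
      · rintro z ⟨hz, -⟩
        rw [abs_of_pos hr.1] at hz
        exact hg z (Metric.closedBall_subset_closedBall hr.2.le (Metric.ball_subset_closedBall hz))
    rw [Real.circleAverage_eq_integral_add (-Real.pi)] at h1
    rw [← integral_Ioc_eq_integral_Ioo, ← intervalIntegral.integral_of_le (by linarith [Real.pi_pos])]
    rw [intervalIntegral.integral_comp_add_right (fun t => g (circleMap c r t))] at h1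
    rw [← h1]
    have e1 : (0 : ℝ) + -Real.pi = -Real.pi := by ring
    have e2 : 2 * Real.pi + -Real.pi = Real.pi := by ring
    rw [e1, e2, Complex.real_smul, ← mul_assoc, ← Complex.ofReal_mul,
      mul_inv_cancel₀ (by positivity), Complex.ofReal_one, one_mul]
    congr 1
    funext θ
    simp [circleMap, Complex.exp_mul_I]
  -- Continuity on the closed rectangle gives the integrability that Fubini requires.
  have hcont : ContinuousOn (fun p : ℝ × ℝ =>
      p.1 • g (c + p.1 * (Real.cos p.2 + Real.sin p.2 * Complex.I)))
      (Set.Icc 0 R ×ˢ Set.Icc (-Real.pi) Real.pi) := by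
    refine ContinuousOn.smul continuousOn_fst ?_
    refine ContinuousOn.comp (t := Metric.closedBall c R)
      (fun z hz => (hg z hz).continuousAt.continuousWithinAt) (by fun_prop) ?_
    rintro ⟨r, θ⟩ ⟨hr, -⟩
    have : ‖(Real.cos θ + Real.sin θ * Complex.I : ℂ)‖ = 1 := by
      simp [← Complex.exp_mul_I]
    simp only [Metric.mem_closedBall, dist_eq_norm, add_sub_cancel_left, norm_mul, this]
    simpa [abs_of_nonneg hr.1] using hr.2
  have hint : IntegrableOn (fun p : ℝ × ℝ =>
      p.1 • g (c + p.1 * (Real.cos p.2 + Real.sin p.2 * Complex.I)))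
      (Set.Ioo 0 R ×ˢ Set.Ioo (-Real.pi) Real.pi) :=
    (hcont.integrableOn_compact (isCompact_Icc.prod isCompact_Icc)).mono_set
      (Set.prod_mono Set.Ioo_subset_Icc_self Set.Ioo_subset_Icc_self)
  calc ∫ w in Metric.ball c R, g w
      = ∫ w in Metric.ball 0 R, g (c + w) := by
        rw [← integral_indicator Metric.isOpen_ball.measurableSet,
          ← integral_indicator Metric.isOpen_ball.measurableSet,
          ← integral_add_left_eq_self _ c]
        congr 1
        funext w
        simp [Set.indicator]
    _ = ∫ p in polarCoord.target, (Set.Ioo 0 R ×ˢ Set.Ioo (-Real.pi) Real.pi).indicator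
          (fun p : ℝ × ℝ => p.1 • g (c + p.1 * (Real.cos p.2 + Real.sin p.2 * Complex.I))) p := by
        rw [← integral_indicator Metric.isOpen_ball.measurableSet,
          ← Complex.integral_comp_polarCoord_symm]
        refine setIntegral_congr_fun polarCoord.open_target.measurableSet ?_
        rintro ⟨r, θ⟩ ⟨hr, hθ⟩
        simp only [Set.mem_Ioi] at hr
        have hn : ‖Complex.polarCoord.symm (r, θ)‖ = r := by
          rw [Complex.norm_polarCoord_symm, abs_of_pos hr]
        beta_reduce
        rw [Complex.polarCoord_symm_apply] at hn ⊢
        by_cases h : r < R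
        · rw [Set.indicator_of_mem (by simpa only [mem_ball_zero_iff, hn] using h),
            Set.indicator_of_mem (show (r, θ) ∈ Set.Ioo 0 R ×ˢ Set.Ioo (-Real.pi) Real.pi from ⟨⟨hr, h⟩, hθ⟩)]
        · rw [Set.indicator_of_notMem (by simpa only [mem_ball_zero_iff, hn] using h),
            Set.indicator_of_notMem (fun h' => h (Set.mem_prod.mp h').1.2), smul_zero]
    _ = ∫ p in Set.Ioo 0 R ×ˢ Set.Ioo (-Real.pi) Real.pi,
          p.1 • g (c + p.1 * (Real.cos p.2 + Real.sin p.2 * Complex.I)) := by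
        rw [setIntegral_indicator (measurableSet_Ioo.prod measurableSet_Ioo)]
        congr 2
        apply Set.inter_eq_right.mpr
        exact Set.prod_mono (fun x hx => hx.1) subset_rfl
    _ = ∫ r in Set.Ioo 0 R, r • ((2 * Real.pi : ℝ) * g c) := by
        rw [Measure.volume_eq_prod, setIntegral_prod _ (by rwa [← Measure.volume_eq_prod])]
        refine setIntegral_congr_fun measurableSet_Ioo fun r hr => ?_
        simp only [integral_smul]
        rw [hcirc r hr]
    _ = (Real.pi * R ^ 2 : ℝ) * g c := by
        rw [integral_smul_const, ← integral_Ioc_eq_integral_Ioo,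
          ← intervalIntegral.integral_of_le hR.le, integral_id]
        rw [Complex.real_smul, ← mul_assoc, ← Complex.ofReal_mul]
        congr 2
        ring

/-- The mean value property on the disc of radius `(1 - r)/2` about `z`, which stays inside the unit
disc; the constant is the inverse square of that radius. -/
theorem norm_apply_le {r : ℝ} (hr : r < 1) (f : A1) {z : ℂ} (hz : ‖z‖ ≤ r) :
    ‖f z‖ ≤ 4 / (1 - r) ^ 2 * ‖f‖ := by
  set R : ℝ := (1 - r) / 2 with hRdef
  have hR : 0 < R := by simp only [hRdef]; linarith
  have hsub : Metric.closedBall z R ⊆ disc := by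
    intro w hw
    rw [mem_disc]
    have h1 : ‖w - z‖ ≤ R := by simpa [dist_eq_norm] using hw
    have h2 : ‖w‖ ≤ ‖w - z‖ + ‖z‖ := by simpa using norm_add_le (w - z) z
    simp only [hRdef] at h1
    linarith
  have hmv := integral_ball_eq_of_differentiableOn (g := f) hR
    fun w hw => f.2.1.differentiableAt (isOpen_disc.mem_nhds (hsub hw))
  have h1 : Real.pi * R ^ 2 * ‖f z‖ ≤ ∫ w in disc, ‖f w‖ := by
    calc Real.pi * R ^ 2 * ‖f z‖ = ‖∫ w in Metric.ball z R, f w‖ := by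
          rw [hmv, norm_mul, Complex.norm_real, Real.norm_of_nonneg (by positivity)]
      _ ≤ ∫ w in Metric.ball z R, ‖f w‖ := norm_integral_le_integral_norm _
      _ ≤ ∫ w in disc, ‖f w‖ :=
          setIntegral_mono_set f.2.2.1.norm (ae_of_all _ fun _ => norm_nonneg _)
            (Metric.ball_subset_closedBall.trans hsub).eventuallyLE
  have h2 : ‖f‖ = Real.pi⁻¹ * ∫ w in disc, ‖f w‖ := A1.norm_def f
  have h3 : R ^ 2 * ‖f z‖ ≤ ‖f‖ := by
    rw [h2, le_inv_mul_iff₀ Real.pi_pos]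
    linarith
  have h4 : 4 / (1 - r) ^ 2 = (R ^ 2)⁻¹ := by
    rw [hRdef, div_pow, inv_div]; norm_num
  rw [h4, le_inv_mul_iff₀ (by positivity)]
  exact h3

/-- Evaluation at a point of the disc, as a continuous linear functional on `A¹`. -/
noncomputable def evalCLM (z : ℂ) (hz : z ∈ disc) : A1 →L[ℂ] ℂ :=
  LinearMap.mkContinuous
    { toFun := fun f => f z
      map_add' := fun _ _ => rfl
      map_smul' := fun _ _ => rfl } (4 / (1 - ‖z‖) ^ 2)
    fun f => norm_apply_le (mem_disc.mp hz) f le_rfl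

@[simp] theorem evalCLM_apply (z : ℂ) (hz : z ∈ disc) (f : A1) : evalCLM z hz f = f z := rfl

/-! ### Integral functionals and the Schur property -/

namespace A1

theorem measurable (f : A1) : Measurable f := by
  have h : (f : ℂ → ℂ) = disc.indicator f := by
    funext z
    by_cases hz : z ∈ disc
    · rw [Set.indicator_of_mem hz]
    · rw [Set.indicator_of_notMem hz, f.2.2.2 z hz]
  classical
  rw [h, ← Set.piecewise_eq_indicator]
  convert! f.2.1.continuousOn.measurable_piecewise (g := 0) continuousOn_const measurableSet_disc

theorem setIntegral_norm (f : A1) : ∫ z in disc, ‖f z‖ = Real.pi * ‖f‖ := by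
  rw [norm_def, mul_inv_cancel_left₀ Real.pi_ne_zero]

theorem integrable_norm (f : A1) : IntegrableOn (fun z => ‖f z‖) disc := f.2.2.1.norm

end A1

theorem closedBall_subset_disc {r : ℝ} (hr : r < 1) : Metric.closedBall 0 r ⊆ disc :=
  Metric.closedBall_subset_ball hr

/-- Integration over a subset of the disc against a function of modulus at most one. -/
noncomputable def pairingCLM (U : Set ℂ) (hU : U ⊆ disc) (hUm : MeasurableSet U)
    (σ : ℂ → ℂ) (hσ : Measurable σ) (hσ1 : ∀ z ∈ U, ‖σ z‖ ≤ 1) : A1 →L[ℂ] ℂ :=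
  have hint : ∀ f : A1, IntegrableOn (fun z => f z * σ z) U := fun f =>
    Integrable.mul_bdd (c := 1) (f.2.2.1.mono_set hU) hσ.aestronglyMeasurable
      (ae_restrict_of_forall_mem hUm hσ1)
  LinearMap.mkContinuous
    { toFun := fun f => ∫ z in U, f z * σ z
      map_add' := fun f g => by
        simp only [A1.add_apply, add_mul]
        exact integral_add (hint f) (hint g)
      map_smul' := fun c f => by
        simp only [A1.smul_apply, mul_assoc]
        exact integral_const_mul c _ } Real.pi fun f => by
    rw [← A1.setIntegral_norm]
    refine (norm_integral_le_integral_norm _).trans ?_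
    refine le_trans (setIntegral_mono_on (hint f).norm (f.integrable_norm.mono_set hU) hUm
      fun z hz => ?_) (setIntegral_mono_set f.integrable_norm
        (ae_of_all _ fun _ => norm_nonneg _) hU.eventuallyLE)
    rw [norm_mul]
    exact mul_le_of_le_one_right (norm_nonneg _) (hσ1 z hz)

theorem pairingCLM_apply (U : Set ℂ) (hU : U ⊆ disc) (hUm : MeasurableSet U)
    (σ : ℂ → ℂ) (hσ : Measurable σ) (hσ1 : ∀ z ∈ U, ‖σ z‖ ≤ 1) (f : A1) :
    pairingCLM U hU hUm σ hσ hσ1 f = ∫ z in U, f z * σ z := rfl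

/-- A weakly null sequence is bounded in norm. -/
theorem exists_norm_le_of_forall_tendsto {X : Type*} [NormedAddCommGroup X] [NormedSpace ℂ X]
    {u : ℕ → X} (hu : ∀ L : X →L[ℂ] ℂ, Tendsto (fun n => L (u n)) atTop (𝓝 0)) :
    ∃ M, ∀ n, ‖u n‖ ≤ M := by
  -- Uniform boundedness is applied on the dual, which is always complete, so completeness of `X` is
  -- not needed.
  obtain ⟨M, hM⟩ := banach_steinhaus
    (g := fun n => NormedSpace.inclusionInDoubleDual ℂ X (u n)) fun L => by
      obtain ⟨C, hC⟩ := (hu L).norm.bddAbove_range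
      exact ⟨C, fun n => hC ⟨n, rfl⟩⟩
  refine ⟨M, fun n => ?_⟩
  rw [← (NormedSpace.inclusionInDoubleDualLi (E := X) ℂ).norm_map]
  exact hM n

/-- Dominated convergence: evaluations are bounded functionals, which gives pointwise convergence,
and `norm_apply_le` gives a constant majorant. -/
theorem tendsto_setIntegral_closedBall_zero {u : ℕ → A1}
    (hu : ∀ L : A1 →L[ℂ] ℂ, Tendsto (fun n => L (u n)) atTop (𝓝 0)) {r : ℝ} (hr : r < 1) :
    Tendsto (fun n => ∫ z in Metric.closedBall 0 r, ‖u n z‖) atTop (𝓝 0) := by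
  obtain ⟨M, hM⟩ := exists_norm_le_of_forall_tendsto hu
  rw [← integral_zero (μ := volume.restrict (Metric.closedBall (0 : ℂ) r)) ℂ ℝ]
  refine tendsto_integral_of_dominated_convergence (fun _ => 4 / (1 - r) ^ 2 * M)
    (fun n => (u n).measurable.norm.aestronglyMeasurable) ?_ (fun n => ?_) ?_
  · exact integrableOn_const (isCompact_closedBall (0 : ℂ) r).measure_ne_top
  · refine ae_restrict_of_forall_mem Metric.isClosed_closedBall.measurableSet fun z hz => ?_
    rw [norm_norm]
    refine (norm_apply_le hr (u n) (by simpa using hz)).trans ?_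
    gcongr
    exact hM n
  · refine ae_restrict_of_forall_mem Metric.isClosed_closedBall.measurableSet fun z hz => ?_
    simpa using (hu (evalCLM z (closedBall_subset_disc hr hz))).norm

theorem exists_setIntegral_sdiff_closedBall_lt (f : A1) (r : ℝ) (hr : r < 1) {δ : ℝ} (hδ : 0 < δ) :
    ∃ s, r < s ∧ s < 1 ∧ ∫ z in disc \ Metric.closedBall 0 s, ‖f z‖ < δ := by
  have hanti : Antitone fun s : ℕ => disc \ Metric.closedBall (0 : ℂ) (1 - 1 / ((s : ℝ) + 1)) := by
    intro m n hmn
    apply Set.sdiff_subset_sdiff_right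
    apply Metric.closedBall_subset_closedBall
    gcongr
  have hlim : Tendsto (fun s : ℕ => 1 - 1 / ((s : ℝ) + 1)) atTop (𝓝 1) := by
    simpa using (tendsto_one_div_add_atTop_nhds_zero_nat (𝕜 := ℝ)).const_sub 1
  have h := tendsto_setIntegral_of_antitone (μ := volume) (f := fun z => ‖f z‖)
    (fun n => measurableSet_disc.diff Metric.isClosed_closedBall.measurableSet) hanti
    ⟨0, f.integrable_norm.mono_set Set.sdiff_subset⟩
  have hempty : ⋂ s : ℕ, disc \ Metric.closedBall (0 : ℂ) (1 - 1 / ((s : ℝ) + 1)) = ∅ := by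
    rw [Set.eq_empty_iff_forall_notMem]
    intro z hz
    rw [Set.mem_iInter] at hz
    have hz1 : ‖z‖ < 1 := mem_disc.mp (hz 0).1
    obtain ⟨s, hs⟩ := (hlim.eventually (lt_mem_nhds hz1)).exists
    exact (hz s).2 (by simpa using hs.le)
  rw [hempty, setIntegral_empty] at h
  obtain ⟨s, hs1, hs2⟩ := ((h.eventually (gt_mem_nhds hδ)).and
    (hlim.eventually (lt_mem_nhds hr))).exists
  refine ⟨_, hs2, ?_, hs1⟩
  have : (0 : ℝ) < 1 / ((s : ℝ) + 1) := by positivity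
  linarith

/-- The gliding hump: mass of the sequence is concentrated on pairwise disjoint annuli. -/
theorem exists_annuli {u : ℕ → A1}
    (hu : ∀ L : A1 →L[ℂ] ℂ, Tendsto (fun n => L (u n)) atTop (𝓝 0)) {ε δ : ℝ} (hδ : 0 < δ)
    (hε : ∃ᶠ n in atTop, ε ≤ ‖u n‖) :
    ∃ (n : ℕ → ℕ) (r : ℕ → ℝ), StrictMono n ∧ StrictMono r ∧ (∀ k, r k < 1) ∧
      ∀ k, ε ≤ ‖u (n k)‖ ∧ ∫ z in Metric.closedBall 0 (r k), ‖u (n k) z‖ < δ ∧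
        ∫ z in disc \ Metric.closedBall 0 (r (k + 1)), ‖u (n k) z‖ < δ := by
  -- A state is an index and a radius. The next index has little mass inside the old radius, and the
  -- next radius is then chosen to leave little of that same term outside.
  have step : ∀ s : ℕ × Set.Iio (1 : ℝ), ∃ t : ℕ × Set.Iio (1 : ℝ), s.1 < t.1 ∧ s.2 < t.2 ∧
      ε ≤ ‖u t.1‖ ∧ ∫ z in Metric.closedBall 0 (s.2 : ℝ), ‖u t.1 z‖ < δ ∧
        ∫ z in disc \ Metric.closedBall 0 (t.2 : ℝ), ‖u t.1 z‖ < δ := by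
    rintro ⟨N, r, hr⟩
    obtain ⟨n, hn, hn1, hn2⟩ := (hε.and_eventually
      (((tendsto_setIntegral_closedBall_zero hu hr).eventually (gt_mem_nhds hδ)).and
        (eventually_gt_atTop N))).exists
    obtain ⟨s, hs, hs1, hs2⟩ := exists_setIntegral_sdiff_closedBall_lt (u n) r hr hδ
    exact ⟨(n, ⟨s, hs1⟩), hn2, hs, hn, hn1, hs2⟩
  choose F hF using step
  set s : ℕ → ℕ × Set.Iio (1 : ℝ) := fun k => F^[k] (0, ⟨0, Set.mem_Iio.mpr zero_lt_one⟩) with hs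
  have hsucc : ∀ k, s (k + 1) = F (s k) := fun k => Function.iterate_succ_apply' _ _ _
  -- The indices are shifted by one against the radii, so that term `n k` lives between `r k` and `r
  -- (k + 1)`.
  refine ⟨fun k => (s (k + 1)).1, fun k => (s k).2, strictMono_nat_of_lt_succ fun k => ?_,
    strictMono_nat_of_lt_succ fun k => ?_, fun k => (s k).2.2, fun k => ?_⟩
  · rw [hsucc (k + 1)]
    exact (hF _).1
  · rw [hsucc k]
    exact (hF _).2.1
  · have h := (hF (s k)).2.2
    rw [← hsucc k] at h
    exact h

/-- The Bergman space `A¹` has the Schur property for null sequences. -/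
theorem tendsto_norm_zero_of_forall_tendsto {u : ℕ → A1}
    (hu : ∀ L : A1 →L[ℂ] ℂ, Tendsto (fun n => L (u n)) atTop (𝓝 0)) :
    Tendsto (fun n => ‖u n‖) atTop (𝓝 0) := by
  by_contra hcon
  obtain ⟨ε, hε, hfreq⟩ : ∃ ε > 0, ∃ᶠ n in atTop, ε ≤ ‖u n‖ := by
    by_contra! h
    refine hcon (tendsto_order.mpr ⟨fun a ha => Eventually.of_forall fun n =>
      ha.trans_le (norm_nonneg _), fun a ha => ?_⟩)
    simpa using h a ha
  obtain ⟨n, r, hn, hr, hr1, hmass⟩ := exists_annuli hu (half_pos hε) hfreq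
  set A : ℕ → Set ℂ := fun k => Metric.closedBall 0 (r (k + 1)) \ Metric.closedBall 0 (r k) with hA
  have hAm : ∀ k, MeasurableSet (A k) := fun k =>
    Metric.isClosed_closedBall.measurableSet.diff Metric.isClosed_closedBall.measurableSet
  have hAd : ∀ k, A k ⊆ disc := fun k => Set.sdiff_subset.trans (closedBall_subset_disc (hr1 _))
  have hdisj : Pairwise (Function.onFun Disjoint A) := by
    refine (pairwise_disjoint_on A).mpr fun i j hij => Set.disjoint_left.mpr fun z hz hz' => ?_
    exact hz'.2 (Metric.closedBall_subset_closedBall (hr.monotone (Nat.succ_le_of_lt hij)) hz.1)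
  -- The conjugate phase. It is `0` at zeros of `u (n k)`, by the convention for division by zero,
  -- and `hgmul` still holds there.
  set g : ℕ → ℂ → ℂ := fun k z => (starRingEnd ℂ) (u (n k) z) / ‖u (n k) z‖ with hg
  have hgm : ∀ k, Measurable (g k) := fun k =>
    (Complex.continuous_conj.measurable.comp (u (n k)).measurable).div
      (Complex.measurable_ofReal.comp (u (n k)).measurable.norm)
  have hg1 : ∀ k z, ‖g k z‖ ≤ 1 := by
    intro k z
    simp only [hg, norm_div, RCLike.norm_conj, Complex.norm_real, norm_norm]
    exact div_self_le_one _
  have hgmul : ∀ k z, u (n k) z * g k z = (‖u (n k) z‖ : ℝ) := by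
    intro k z
    simp only [hg]
    rw [← mul_div_assoc, Complex.mul_conj, Complex.normSq_eq_norm_sq, pow_two, Complex.ofReal_mul,
      mul_self_div_self]
  obtain ⟨σ, hσ, hσg⟩ := exists_measurable_piecewise A hAm g hgm
    (fun i j hij z hz => (Set.disjoint_left.mp (hdisj hij) hz.1 hz.2).elim)
  set U := ⋃ k, A k with hU
  have hUd : U ⊆ disc := Set.iUnion_subset hAd
  have hUm : MeasurableSet U := MeasurableSet.iUnion hAm
  have hσ1 : ∀ z ∈ U, ‖σ z‖ ≤ 1 := by
    intro z hz
    obtain ⟨k, hk⟩ := Set.mem_iUnion.mp hz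
    rw [hσg k hk]
    exact hg1 k z
  have hlow : ∀ k, ε ≤ ‖pairingCLM U hUd hUm σ hσ hσ1 (u (n k))‖ := by
    intro k
    obtain ⟨h1, h2, h3⟩ := hmass k
    have hAU : A k ⊆ U := Set.subset_iUnion A k
    have hint : IntegrableOn (fun z => u (n k) z * σ z) U :=
      Integrable.mul_bdd (c := 1) ((u (n k)).2.2.1.mono_set hUd) hσ.aestronglyMeasurable
        (ae_restrict_of_forall_mem hUm hσ1)
    have hsplit : ∫ z in U, u (n k) z * σ z
        = (∫ z in U \ A k, u (n k) z * σ z) + ((∫ z in A k, ‖u (n k) z‖ : ℝ) : ℂ) := by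
      have : ((∫ z in A k, ‖u (n k) z‖ : ℝ) : ℂ) = ∫ z in A k, u (n k) z * σ z := by
        refine integral_complex_ofReal.symm.trans (setIntegral_congr_fun (hAm k) fun z hz => ?_)
        simp only [hσg k hz, hgmul]
      rw [this, setIntegral_sdiff (hAm k) hint hAU, sub_add_cancel]
    have hrest : ‖∫ z in U \ A k, u (n k) z * σ z‖ ≤ ∫ z in disc \ A k, ‖u (n k) z‖ := by
      refine (norm_integral_le_integral_norm _).trans ?_
      refine le_trans (setIntegral_mono_on (hint.mono_set Set.sdiff_subset).norm
        ((u (n k)).integrable_norm.mono_set (Set.sdiff_subset.trans hUd)) (hUm.diff (hAm k))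
        fun z hz => ?_) (setIntegral_mono_set
          ((u (n k)).integrable_norm.mono_set Set.sdiff_subset)
          (ae_of_all _ fun _ => norm_nonneg _) (Set.sdiff_subset_sdiff_left hUd).eventuallyLE)
      rw [norm_mul]
      exact mul_le_of_le_one_right (norm_nonneg _) (hσ1 z hz.1)
    have hout : ∫ z in disc \ A k, ‖u (n k) z‖ < ε := by
      have hcb : Metric.closedBall 0 (r k) ⊆ disc := closedBall_subset_disc (hr1 k)
      have hsub : disc \ A k ⊆
          Metric.closedBall 0 (r k) ∪ disc \ Metric.closedBall 0 (r (k + 1)) := by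
        intro z hz
        by_cases h : z ∈ Metric.closedBall 0 (r k)
        · exact Or.inl h
        · exact Or.inr ⟨hz.1, fun h' => hz.2 ⟨h', h⟩⟩
      have hdj : Disjoint (Metric.closedBall 0 (r k)) (disc \ Metric.closedBall 0 (r (k + 1))) :=
        Set.disjoint_left.mpr fun z hz hz' => hz'.2
          (Metric.closedBall_subset_closedBall (hr.monotone k.le_succ) hz)
      have := setIntegral_mono_set (s := disc \ A k)
        ((u (n k)).integrable_norm.mono_set (Set.union_subset hcb Set.sdiff_subset))
        (ae_of_all _ fun _ => norm_nonneg _) hsub.eventuallyLE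
      rw [setIntegral_union hdj (measurableSet_disc.diff Metric.isClosed_closedBall.measurableSet)
        ((u (n k)).integrable_norm.mono_set hcb)
        ((u (n k)).integrable_norm.mono_set Set.sdiff_subset)] at this
      linarith
    have hin : ∫ z in A k, ‖u (n k) z‖
        = Real.pi * ‖u (n k)‖ - ∫ z in disc \ A k, ‖u (n k) z‖ := by
      rw [setIntegral_sdiff (hAm k) (u (n k)).integrable_norm (hAd k), A1.setIntegral_norm]
      ring
    rw [pairingCLM_apply, hsplit]
    have htri := norm_sub_le_norm_add ((∫ z in A k, ‖u (n k) z‖ : ℝ) : ℂ)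
      (∫ z in U \ A k, u (n k) z * σ z)
    rw [Complex.norm_real, add_comm ((∫ z in A k, ‖u (n k) z‖ : ℝ) : ℂ)] at htri
    have habs := le_abs_self (∫ z in A k, ‖u (n k) z‖)
    rw [← Real.norm_eq_abs] at habs
    -- Of a total mass at least `3ε`, less than `ε` lies off the annulus; it is subtracted once from
    -- the main term and once as the error, leaving `ε`.
    have hpi : 3 * ε ≤ Real.pi * ‖u (n k)‖ :=
      mul_le_mul Real.pi_gt_three.le h1 hε.le Real.pi_pos.le
    linarith
  have hL := ((hu (pairingCLM U hUd hUm σ hσ hσ1)).comp hn.tendsto_atTop).norm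
  rw [norm_zero] at hL
  obtain ⟨k, hk⟩ := (hL.eventually (gt_mem_nhds hε)).exists
  exact absurd hk (not_lt.mpr (hlow k))

/-- The Schur property applied to `u n - x` makes weak convergence norm convergence, which
continuity of `T` preserves. -/
theorem completelyContinuous_of_A1 {Y : Type*} [NormedAddCommGroup Y] [NormedSpace ℂ Y]
    (T : A1 →L[ℂ] Y) : CompletelyContinuous T := by
  intro u x hux
  refine (T.continuous.tendsto x).comp (tendsto_iff_norm_sub_tendsto_zero.mpr ?_)
  refine tendsto_norm_zero_of_forall_tendsto fun L => ?_
  have h1 : Tendsto (fun n => L (u n)) atTop (𝓝 (L x)) :=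
    ((WeakBilin.eval_continuous (topDualPairing ℂ A1).flip L).tendsto _).comp hux
  simpa using h1.sub_const (L x)

/-! ### Power integrals in polar coordinates and the test functions -/

theorem lintegral_Ioo_mul_rpow_neg {a δ : ℝ} (ha : a < 2) (hδ : 0 < δ) :
    ∫⁻ r in Set.Ioo 0 δ, ENNReal.ofReal r * ENNReal.ofReal (r ^ (-a))
      = ENNReal.ofReal (δ ^ (2 - a) / (2 - a)) := by
  have h1 : ∫⁻ r in Set.Ioo 0 δ, ENNReal.ofReal r * ENNReal.ofReal (r ^ (-a))
      = ∫⁻ r in Set.Ioo 0 δ, ENNReal.ofReal (r ^ (1 - a)) := by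
    refine setLIntegral_congr_fun measurableSet_Ioo fun r hr => ?_
    rw [← ENNReal.ofReal_mul hr.1.le, sub_eq_add_neg, Real.rpow_add hr.1, Real.rpow_one]
  have hint : IntegrableOn (fun r : ℝ => r ^ (1 - a)) (Set.Ioo 0 δ) :=
    ((intervalIntegrable_iff_integrableOn_Ioo_of_le hδ.le).mp
      (intervalIntegral.intervalIntegrable_rpow' (by linarith)))
  rw [h1, ← ofReal_integral_eq_lintegral_ofReal hint
    (ae_restrict_of_forall_mem measurableSet_Ioo fun r hr => Real.rpow_nonneg hr.1.le _),
    ← integral_Ioc_eq_integral_Ioo, ← intervalIntegral.integral_of_le hδ.le,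
    integral_rpow (Or.inl (by linarith))]
  have e : 1 - a + 1 = 2 - a := by ring
  rw [e, Real.zero_rpow (by linarith), sub_zero]

/-- The integral of a power of the modulus over a set that is a circular sector in polar
coordinates. -/
theorem lintegral_sector_norm_rpow_neg {a δ Θ : ℝ} (ha : a < 2) (hδ : 0 < δ)
    (hΘ : Θ ≤ Real.pi) {A : Set ℂ} (hAm : MeasurableSet A)
    (hA : ∀ r > 0, ∀ θ ∈ Set.Ioo (-Real.pi) Real.pi,
      (Complex.polarCoord.symm (r, θ) ∈ A ↔ r < δ ∧ θ ∈ Set.Ioo (-Θ) Θ)) :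
    ∫⁻ w in A, ENNReal.ofReal (‖w‖ ^ (-a))
      = ENNReal.ofReal (δ ^ (2 - a) / (2 - a)) * ENNReal.ofReal (2 * Θ) := by
  have hmeas : MeasurableSet (Set.Ioo 0 δ ×ˢ Set.Ioo (-Θ) Θ) :=
    measurableSet_Ioo.prod measurableSet_Ioo
  calc ∫⁻ w in A, ENNReal.ofReal (‖w‖ ^ (-a))
      = ∫⁻ p in polarCoord.target, (Set.Ioo 0 δ ×ˢ Set.Ioo (-Θ) Θ).indicator
          (fun p : ℝ × ℝ => ENNReal.ofReal p.1 * ENNReal.ofReal (p.1 ^ (-a))) p := by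
        rw [← lintegral_indicator hAm, ← Complex.lintegral_comp_polarCoord_symm]
        refine setLIntegral_congr_fun polarCoord.open_target.measurableSet ?_
        rintro ⟨r, θ⟩ ⟨hr, hθ⟩
        simp only [Set.mem_Ioi] at hr
        have hn : ‖Complex.polarCoord.symm (r, θ)‖ = r := by
          rw [Complex.norm_polarCoord_symm, abs_of_pos hr]
        beta_reduce
        by_cases h : r < δ ∧ θ ∈ Set.Ioo (-Θ) Θ
        · rw [Set.indicator_of_mem ((hA r hr θ hθ).mpr h), hn, smul_eq_mul, Set.indicator_of_mem
            (show (r, θ) ∈ Set.Ioo 0 δ ×ˢ Set.Ioo (-Θ) Θ from ⟨⟨hr, h.1⟩, h.2⟩)]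
        · rw [Set.indicator_of_notMem (fun h' => h ((hA r hr θ hθ).mp h')), smul_zero,
            Set.indicator_of_notMem
              (fun h' => h ⟨(Set.mem_prod.mp h').1.2, (Set.mem_prod.mp h').2⟩)]
    _ = ∫⁻ p in Set.Ioo 0 δ ×ˢ Set.Ioo (-Θ) Θ,
          ENNReal.ofReal p.1 * ENNReal.ofReal (p.1 ^ (-a)) := by
        rw [setLIntegral_indicator hmeas]
        congr 2
        apply Set.inter_eq_left.mpr
        exact Set.prod_mono (fun x hx => hx.1) (Set.Ioo_subset_Ioo (neg_le_neg hΘ) hΘ)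
    _ = ENNReal.ofReal (δ ^ (2 - a) / (2 - a)) * ENNReal.ofReal (2 * Θ) := by
        rw [Measure.volume_eq_prod, ← Measure.prod_restrict,
          lintegral_prod _ (by fun_prop)]
        simp only [lintegral_const, Measure.restrict_apply_univ, Real.volume_Ioo]
        rw [lintegral_mul_const _ (by fun_prop), lintegral_Ioo_mul_rpow_neg ha hδ]
        congr 2
        ring

/-- The function `(1 - z) ^ (-a)` on the disc, extended by zero. -/
noncomputable def testFun (a : ℝ) : ℂ → ℂ :=
  disc.indicator fun z => Complex.exp (-a * Complex.log (1 - z))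

theorem one_sub_re_pos {z : ℂ} (hz : z ∈ disc) : 0 < (1 - z).re := by
  have h := Complex.re_le_norm z
  rw [mem_disc] at hz
  simp only [Complex.sub_re, Complex.one_re]
  linarith

theorem one_sub_ne_zero {z : ℂ} (hz : z ∈ disc) : 1 - z ≠ 0 := fun h => by
  have := one_sub_re_pos hz
  simp [h] at this

theorem norm_testFun (a : ℝ) {z : ℂ} (hz : z ∈ disc) : ‖testFun a z‖ = ‖1 - z‖ ^ (-a) := by
  rw [testFun, Set.indicator_of_mem hz, Complex.norm_exp,
    Real.rpow_def_of_pos (norm_pos_iff.mpr (one_sub_ne_zero hz)), ← Complex.ofReal_neg,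
    Complex.re_ofReal_mul, Complex.log_re, mul_comm]

theorem differentiableOn_testFun (a : ℝ) : DifferentiableOn ℂ (testFun a) disc := by
  have h : DifferentiableOn ℂ (fun z => Complex.exp (-a * Complex.log (1 - z))) disc := by
    refine DifferentiableOn.cexp ((DifferentiableOn.clog (by fun_prop) fun z hz => ?_).const_mul _)
    exact Or.inl (one_sub_re_pos hz)
  exact h.congr fun z hz => by rw [testFun, Set.indicator_of_mem hz]

theorem lintegral_norm_testFun_le {a : ℝ} (ha : a < 2) :
    ∫⁻ z in disc, ENNReal.ofReal ‖testFun a z‖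
      ≤ ENNReal.ofReal (2 ^ (2 - a) / (2 - a) * (2 * Real.pi)) := by
  have hball : MeasurableSet (Metric.ball (0 : ℂ) 2) := Metric.isOpen_ball.measurableSet
  calc ∫⁻ z in disc, ENNReal.ofReal ‖testFun a z‖
      ≤ ∫⁻ z, (Metric.ball (0 : ℂ) 2).indicator
          (fun w => ENNReal.ofReal (‖w‖ ^ (-a))) (1 - z) := by
        rw [← lintegral_indicator measurableSet_disc]
        refine lintegral_mono fun z => ?_
        by_cases hz : z ∈ disc
        · have hz2 : 1 - z ∈ Metric.ball (0 : ℂ) 2 := by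
            have := norm_sub_le 1 z
            rw [mem_disc] at hz
            rw [norm_one] at this
            rw [mem_ball_zero_iff]
            linarith
          rw [Set.indicator_of_mem hz, Set.indicator_of_mem hz2, norm_testFun a hz]
        · rw [Set.indicator_of_notMem hz]
          exact zero_le
    _ = ∫⁻ w in Metric.ball (0 : ℂ) 2, ENNReal.ofReal (‖w‖ ^ (-a)) := by
        rw [lintegral_sub_left_eq_self, lintegral_indicator hball]
    _ = ENNReal.ofReal (2 ^ (2 - a) / (2 - a) * (2 * Real.pi)) := by
        rw [lintegral_sector_norm_rpow_neg ha two_pos le_rfl hball, ← ENNReal.ofReal_mul]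
        · exact div_nonneg (Real.rpow_nonneg zero_le_two _) (by linarith)
        · intro r hr θ hθ
          rw [mem_ball_zero_iff, Complex.norm_polarCoord_symm, abs_of_pos hr]
          exact ⟨fun h => ⟨h, hθ⟩, fun h => h.1⟩

theorem testFun_mem {a : ℝ} (ha : a < 2) : testFun a ∈ bergmanSubmodule := by
  refine ⟨differentiableOn_testFun a,
    ⟨(differentiableOn_testFun a).continuousOn.aestronglyMeasurable measurableSet_disc, ?_⟩,
    fun z hz => by rw [testFun, Set.indicator_of_notMem hz]⟩
  rw [hasFiniteIntegral_iff_norm]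
  exact (lintegral_norm_testFun_le ha).trans_lt ENNReal.ofReal_lt_top

/-- The function `(1 - z) ^ (-a)` as an element of `A¹`. -/
noncomputable def testA1 (a : ℝ) (ha : a < 2) : A1 := A1.mk (testFun a) (testFun_mem ha)

theorem testA1_apply (a : ℝ) (ha : a < 2) (z : ℂ) : testA1 a ha z = testFun a z := rfl

theorem norm_testA1_le {a : ℝ} (ha1 : 1 ≤ a) (ha : a < 2) : ‖testA1 a ha‖ ≤ 4 / (2 - a) := by
  have hpos : 0 < 2 - a := by linarith
  have h1 : ∫ z in disc, ‖testA1 a ha z‖ ≤ 2 ^ (2 - a) / (2 - a) * (2 * Real.pi) := by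
    rw [← ENNReal.ofReal_le_ofReal_iff (by positivity),
      ofReal_integral_eq_lintegral_ofReal (testA1 a ha).integrable_norm
        (ae_of_all _ fun _ => norm_nonneg _)]
    exact lintegral_norm_testFun_le ha
  rw [A1.setIntegral_norm] at h1
  have h2 : (2 : ℝ) ^ (2 - a) ≤ 2 := by
    simpa using Real.rpow_le_rpow_of_exponent_le one_le_two (show 2 - a ≤ 1 by linarith)
  have h3 : Real.pi * ‖testA1 a ha‖ ≤ Real.pi * (4 / (2 - a)) := by
    refine h1.trans ?_
    calc (2 : ℝ) ^ (2 - a) / (2 - a) * (2 * Real.pi) ≤ 2 / (2 - a) * (2 * Real.pi) := by gcongr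
      _ = Real.pi * (4 / (2 - a)) := by ring
  exact le_of_mul_le_mul_left h3 Real.pi_pos

/-- In this sector `2 Re w > |w| > |w|²`, hence `|1 - w|² = 1 - 2 Re w + |w|² < 1`. -/
theorem one_sub_mem_disc_of_abs_arg_lt {w : ℂ} (hw0 : w ≠ 0) (hw1 : ‖w‖ < 1)
    (harg : |Complex.arg w| < Real.pi / 3) : 1 - w ∈ disc := by
  have hpos := norm_pos_iff.mpr hw0
  have hcos : 1 / 2 < Real.cos (Complex.arg w) := by
    rw [← Real.cos_pi_div_three, ← Real.cos_abs (Complex.arg w)]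
    exact Real.cos_lt_cos_of_nonneg_of_le_pi (abs_nonneg _) (by linarith [Real.pi_pos]) harg
  have hre : ‖w‖ / 2 < w.re := by
    rw [Complex.cos_arg hw0, lt_div_iff₀ hpos] at hcos
    linarith
  have hsq : ‖1 - w‖ ^ 2 = 1 - 2 * w.re + ‖w‖ ^ 2 := by
    rw [← Complex.normSq_eq_norm_sq, ← Complex.normSq_eq_norm_sq, Complex.normSq_apply,
      Complex.normSq_apply]
    simp only [Complex.sub_re, Complex.sub_im, Complex.one_re, Complex.one_im]
    ring
  rw [mem_disc, ← sq_lt_one_iff₀ (norm_nonneg _), hsq]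
  nlinarith

/-- Near `1` the disc contains a sector with vertex `1` and half-angle `π/3`. After multiplication
by `2 - a` the bound tends to `2` as `a → 2`, whatever `δ` is. -/
theorem le_setIntegral_norm_testA1 {a δ : ℝ} (ha : a < 2) (hδ : 0 < δ) (hδ1 : δ ≤ 1) :
    2 * δ ^ (2 - a) / (2 - a) ≤ ∫ z in disc ∩ Metric.ball 1 δ, ‖testA1 a ha z‖ := by
  have hpos : 0 < 2 - a := by linarith
  have hS : MeasurableSet (disc ∩ Metric.ball (1 : ℂ) δ) :=
    measurableSet_disc.inter Metric.isOpen_ball.measurableSet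
  -- The vertex must be removed by hand: `Complex.arg 0 = 0`, but `1 - 0` is not in the disc.
  set A : Set ℂ := {0}ᶜ ∩ ({w | ‖w‖ < δ} ∩ {w | |Complex.arg w| < Real.pi / 3}) with hA
  have hAm : MeasurableSet A := by
    refine (measurableSet_singleton (0 : ℂ)).compl.inter
      ((measurableSet_lt measurable_norm measurable_const).inter
        (measurableSet_lt ?_ measurable_const))
    exact continuous_abs.measurable.comp Complex.measurable_arg
  have hsec := lintegral_sector_norm_rpow_neg (Θ := Real.pi / 3) ha hδ
    (by linarith [Real.pi_pos]) hAm (by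
      intro r hr θ hθ
      have hn : ‖Complex.polarCoord.symm (r, θ)‖ = r := by
        rw [Complex.norm_polarCoord_symm, abs_of_pos hr]
      have harg : Complex.arg (Complex.polarCoord.symm (r, θ)) = θ := by
        rw [Complex.polarCoord_symm_apply]
        simpa using Complex.arg_mul_cos_add_sin_mul_I hr ⟨hθ.1, hθ.2.le⟩
      rw [hA, Set.mem_inter_iff, Set.mem_inter_iff, Set.mem_ofPred_eq, Set.mem_ofPred_eq,
        Set.mem_compl_singleton_iff, harg, hn, abs_lt, ← norm_pos_iff, hn]
      exact ⟨fun h => h.2, fun h => ⟨hr, h⟩⟩)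
  rw [← ENNReal.ofReal_le_ofReal_iff (by positivity),
    ofReal_integral_eq_lintegral_ofReal
      ((testA1 a ha).integrable_norm.mono_set Set.inter_subset_left)
      (ae_of_all _ fun _ => norm_nonneg _)]
  calc ENNReal.ofReal (2 * δ ^ (2 - a) / (2 - a))
      ≤ ENNReal.ofReal (δ ^ (2 - a) / (2 - a)) * ENNReal.ofReal (2 * (Real.pi / 3)) := by
        rw [← ENNReal.ofReal_mul (by positivity)]
        apply ENNReal.ofReal_le_ofReal
        rw [mul_div_assoc, mul_comm]
        gcongr
        linarith [Real.pi_gt_three]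
    _ = ∫⁻ w, A.indicator (fun w => ENNReal.ofReal (‖w‖ ^ (-a))) w := by
        rw [← hsec, lintegral_indicator hAm]
    _ = ∫⁻ z, A.indicator (fun w => ENNReal.ofReal (‖w‖ ^ (-a))) (1 - z) :=
        (lintegral_sub_left_eq_self _ 1).symm
    _ ≤ ∫⁻ z in disc ∩ Metric.ball 1 δ, ENNReal.ofReal ‖testA1 a ha z‖ := by
        rw [← lintegral_indicator hS]
        refine lintegral_mono fun z => ?_
        by_cases hz : 1 - z ∈ A
        · have hzd : z ∈ disc := by
            simpa using one_sub_mem_disc_of_abs_arg_lt hz.1 (hz.2.1.trans_le hδ1) hz.2.2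
          have hzb : z ∈ Metric.ball (1 : ℂ) δ := by
            rw [Metric.mem_ball, dist_comm, dist_eq_norm]
            exact hz.2.1
          rw [Set.indicator_of_mem hz, Set.indicator_of_mem (Set.mem_inter hzd hzb), testA1_apply,
            norm_testFun a hzd]
        · rw [Set.indicator_of_notMem hz]
          exact zero_le

/-! ### The action of `Γ_μ` on the test functions -/

theorem lt_re_one_add_sub_one_mul {t : ℝ} (ht : t < 1) {z : ℂ} (hz : z ∈ disc) :
    t < (1 + (t - 1) * z : ℂ).re := by
  have h := Complex.re_le_norm z
  rw [mem_disc] at hz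
  have h2 : (1 + (t - 1) * z : ℂ).re = 1 - (1 - t) * z.re := by
    simp
    ring
  rw [h2]
  nlinarith

theorem phi_mem_disc {t : ℝ} (ht0 : 0 ≤ t) (ht : t < 1) {z : ℂ} (hz : z ∈ disc) :
    phi t z ∈ disc := by
  have h := (lt_re_one_add_sub_one_mul ht hz).trans_le (Complex.re_le_norm _)
  rw [mem_disc, phi, norm_div, Complex.norm_real, Real.norm_of_nonneg ht0,
    div_lt_one (ht0.trans_lt h)]
  exact h

/-- No branch correction occurs: `1 - z` and `1 + (t - 1)z` lie in the right half-plane, so their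
arguments differ by less than `π`. -/
theorem log_one_sub_phi {t : ℝ} (ht0 : 0 ≤ t) (ht : t < 1) {z : ℂ} (hz : z ∈ disc) :
    Complex.log (1 - phi t z) =
      Real.log (1 - t) + Complex.log (1 - z) - Complex.log (1 + (t - 1) * z) := by
  have hζre := ht0.trans_lt (lt_re_one_add_sub_one_mul ht hz)
  have hζ : (1 + (t - 1) * z : ℂ) ≠ 0 := fun h => by simp [h] at hζre
  have h1t : (1 - t : ℝ) ≠ 0 := by linarith
  have hexp : 1 - phi t z = Complex.exp (Real.log (1 - t) + Complex.log (1 - z) -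
      Complex.log (1 + (t - 1) * z)) := by
    rw [Complex.exp_sub, Complex.exp_add, Complex.exp_log hζ, Complex.exp_log (one_sub_ne_zero hz),
      ← Complex.ofReal_exp, Real.exp_log (by linarith), phi, eq_div_iff hζ, sub_mul,
      div_mul_cancel₀ _ hζ]
    push_cast
    ring
  have him : (Real.log (1 - t) + Complex.log (1 - z) - Complex.log (1 + (t - 1) * z)).im =
      Complex.arg (1 - z) - Complex.arg (1 + (t - 1) * z) := by
    rw [Complex.sub_im, Complex.add_im, Complex.log_im, Complex.log_im, Complex.ofReal_im, zero_add]
  have h1 := abs_lt.mp (Complex.abs_arg_lt_pi_div_two_iff.mpr (Or.inl (one_sub_re_pos hz)))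
  have h2 := abs_lt.mp (Complex.abs_arg_lt_pi_div_two_iff.mpr (Or.inl hζre))
  rw [hexp, Complex.log_exp]
  · rw [him]; linarith
  · rw [him]; linarith

theorem testFun_phi_mul_weight (a : ℝ) {t : ℝ} (ht0 : 0 ≤ t) (ht : t < 1) {z : ℂ}
    (hz : z ∈ disc) :
    testFun a (phi t z) * weight t z = testFun a z *
      (((1 - t) ^ (-a) : ℝ) * Complex.exp ((a - 1 : ℝ) * Complex.log (1 + (t - 1) * z))) := by
  have hζre := ht0.trans_lt (lt_re_one_add_sub_one_mul ht hz)
  have hζ : (1 + (t - 1) * z : ℂ) ≠ 0 := fun h => by simp [h] at hζre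
  have hw : weight t z = Complex.exp (-Complex.log (1 + (t - 1) * z)) := by
    rw [Complex.exp_neg, Complex.exp_log hζ, weight, one_div]
  have hr : (((1 - t) ^ (-a) : ℝ) : ℂ) = Complex.exp (-a * Real.log (1 - t)) := by
    rw [Real.rpow_def_of_pos (by linarith), Complex.ofReal_exp]
    congr 1
    push_cast
    ring
  rw [testFun, Set.indicator_of_mem (phi_mem_disc ht0 ht hz), Set.indicator_of_mem hz, hw, hr,
    log_one_sub_phi ht0 ht hz, ← Complex.exp_add, ← Complex.exp_add, ← Complex.exp_add]
  congr 1
  push_cast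
  ring

/-- Passing from `ζ` to `ζ^b` shrinks the argument, so its cosine does not decrease, while
`|ζ|^(1-b) ≤ 2` gives `|ζ|^b ≥ |ζ|/2`. -/
theorem half_re_le_re_exp_mul_log {b : ℝ} (hb0 : 0 ≤ b) (hb1 : b ≤ 1) {ζ : ℂ} (hre : 0 < ζ.re)
    (hζ2 : ‖ζ‖ ≤ 2) : ζ.re / 2 ≤ (Complex.exp (b * Complex.log ζ)).re := by
  have hζ : ζ ≠ 0 := fun h => by simp [h] at hre
  have hpos : 0 < ‖ζ‖ := norm_pos_iff.mpr hζ
  have hformula : (Complex.exp (b * Complex.log ζ)).re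
      = ‖ζ‖ ^ b * Real.cos (b * Complex.arg ζ) := by
    rw [Complex.exp_re, Complex.re_ofReal_mul, Complex.im_ofReal_mul, Complex.log_re,
      Complex.log_im, Real.rpow_def_of_pos hpos, mul_comm b]
  have hcos : ζ.re / ‖ζ‖ ≤ Real.cos (b * Complex.arg ζ) := by
    rw [← Complex.cos_arg hζ, ← Real.cos_abs (Complex.arg ζ), ← Real.cos_abs (b * _), abs_mul,
      abs_of_nonneg hb0]
    refine Real.cos_le_cos_of_nonneg_of_le_pi (by positivity) (Complex.abs_arg_le_pi ζ) ?_
    exact mul_le_of_le_one_left (abs_nonneg _) hb1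
  have hpow : ‖ζ‖ / 2 ≤ ‖ζ‖ ^ b := by
    have h1 : ‖ζ‖ ^ b * ‖ζ‖ ^ (1 - b) = ‖ζ‖ := by
      rw [← Real.rpow_add hpos, add_sub_cancel, Real.rpow_one]
    have h2 : ‖ζ‖ ^ (1 - b) ≤ 2 :=
      calc ‖ζ‖ ^ (1 - b) ≤ 2 ^ (1 - b) := Real.rpow_le_rpow hpos.le hζ2 (by linarith)
        _ ≤ 2 ^ (1 : ℝ) := Real.rpow_le_rpow_of_exponent_le one_le_two (by linarith)
        _ = 2 := Real.rpow_one 2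
    have h3 := mul_le_mul_of_nonneg_left h2 (Real.rpow_nonneg hpos.le b)
    linarith
  rw [hformula]
  calc ζ.re / 2 = ‖ζ‖ / 2 * (ζ.re / ‖ζ‖) := by field_simp
    _ ≤ ‖ζ‖ ^ b * Real.cos (b * Complex.arg ζ) :=
      mul_le_mul hpow hcos (by positivity) (by positivity)

variable {μ : Measure (Set.Ico (0 : ℝ) 1)}

theorem gammaOp_apply (h : GammaBounded μ) (f : A1) {z : ℂ} (hz : z ∈ disc) :
    gammaOp μ h f z = ∫ t : Set.Ico (0 : ℝ) 1, f (phi t z) * weight t z ∂μ :=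
  Set.indicator_of_mem hz fun z => ∫ t : Set.Ico (0 : ℝ) 1, f (phi t z) * weight t z ∂μ

theorem integrable_coe_Ico [IsFiniteMeasure μ] :
    Integrable (fun t : Set.Ico (0 : ℝ) 1 => (t : ℝ)) μ :=
  Integrable.of_bound measurable_subtype_coe.aestronglyMeasurable 1
    (ae_of_all _ fun t => by
      rw [Real.norm_of_nonneg t.2.1]
      exact t.2.2.le)

/-- The factor `f_a(z)` leaves the integral, and the remaining kernel has real part at least `t/2`,
so there is no cancellation in `t`. -/
theorem mul_norm_testA1_le_norm_gammaOp [IsFiniteMeasure μ] (h : GammaBounded μ) {a : ℝ}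
    (ha1 : 1 ≤ a) (ha : a < 2) {z : ℂ} (hz : z ∈ disc) :
    (∫ t : Set.Ico (0 : ℝ) 1, (t : ℝ) / 2 ∂μ) * ‖testA1 a ha z‖
      ≤ ‖gammaOp μ h (testA1 a ha) z‖ := by
  set k : Set.Ico (0 : ℝ) 1 → ℂ := fun t => ((1 - t : ℝ) ^ (-a) : ℝ) *
    Complex.exp ((a - 1 : ℝ) * Complex.log (1 + ((t : ℝ) - 1) * z)) with hk
  have heq : (fun t : Set.Ico (0 : ℝ) 1 => testA1 a ha (phi t z) * weight t z)
      = fun t => testFun a z * k t :=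
    funext fun t => testFun_phi_mul_weight a t.2.1 t.2.2 hz
  have hne : testFun a z ≠ 0 := by
    rw [testFun, Set.indicator_of_mem hz]
    exact Complex.exp_ne_zero _
  have hint : Integrable k μ := by
    have h1 := h.integrable (testA1 a ha) z hz
    rw [heq] at h1
    exact (integrable_const_mul_iff (IsUnit.mk0 _ hne) k).mp h1
  have hre : ∀ t : Set.Ico (0 : ℝ) 1, (t : ℝ) / 2 ≤ (k t).re := by
    intro t
    have ht := lt_re_one_add_sub_one_mul t.2.2 hz
    have hz1 := mem_disc.mp hz
    have hnorm : ‖(1 + ((t : ℝ) - 1) * z : ℂ)‖ ≤ 2 := by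
      have h1 : ‖(((t : ℝ) : ℂ) - 1)‖ ≤ 1 := by
        rw [← Complex.ofReal_one, ← Complex.ofReal_sub, Complex.norm_real, Real.norm_eq_abs,
          abs_le]
        constructor <;> linarith [t.2.1, t.2.2]
      calc ‖(1 + ((t : ℝ) - 1) * z : ℂ)‖ ≤ ‖(1 : ℂ)‖ + ‖(((t : ℝ) : ℂ) - 1) * z‖ := norm_add_le _ _
        _ ≤ 1 + 1 * 1 := by
          rw [norm_one, norm_mul]
          gcongr
        _ = 2 := by norm_num
    have h2 := half_re_le_re_exp_mul_log (b := a - 1) (by linarith) (by linarith)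
      (t.2.1.trans_lt ht) hnorm
    have h3 : 1 ≤ (1 - t : ℝ) ^ (-a) :=
      Real.one_le_rpow_of_pos_of_le_one_of_nonpos (by linarith [t.2.2]) (by linarith [t.2.1])
        (by linarith)
    simp only [hk]
    rw [Complex.re_ofReal_mul]
    have h4 := t.2.1
    nlinarith
  rw [gammaOp_apply h _ hz, heq, integral_const_mul, norm_mul, testA1_apply, mul_comm]
  refine mul_le_mul_of_nonneg_left ?_ (norm_nonneg _)
  refine le_trans ?_ (Complex.re_le_norm _)
  have hre_int : (∫ t, k t ∂μ).re = ∫ t, (k t).re ∂μ :=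
    (integral_re hint).symm
  rw [hre_int]
  exact integral_mono (integrable_coe_Ico.div_const 2) hint.re hre

/-! ### Compactness and the Dirac mass -/

theorem integral_pos_of_ne_dirac [IsProbabilityMeasure μ] (hμ : μ ≠ Measure.dirac 0) :
    0 < ∫ t : Set.Ico (0 : ℝ) 1, (t : ℝ) / 2 ∂μ := by
  have hnn : 0 ≤ fun t : Set.Ico (0 : ℝ) 1 => (t : ℝ) / 2 := fun t => div_nonneg t.2.1 zero_le_two
  refine lt_of_le_of_ne (integral_nonneg hnn) fun h0 => hμ ?_
  have hae := (integral_eq_zero_iff_of_nonneg hnn (integrable_coe_Ico.div_const 2)).mp h0.symm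
  have hae' : ∀ᵐ t ∂μ, t = (0 : Set.Ico (0 : ℝ) 1) := by
    filter_upwards [hae] with t ht
    apply Subtype.ext
    simpa using ht
  ext s hs
  rw [Measure.dirac_apply' _ hs]
  by_cases h : (0 : Set.Ico (0 : ℝ) 1) ∈ s
  · rw [Set.indicator_of_mem h, Pi.one_apply, prob_compl_eq_zero_iff hs |>.symm]
    exact measure_mono_null (fun t ht (ht0 : t = 0) => ht (by rwa [ht0])) (ae_iff.mp hae')
  · rw [Set.indicator_of_notMem h]
    exact measure_mono_null (fun t ht (ht0 : t = 0) => h (by rwa [← ht0])) (ae_iff.mp hae')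

theorem tendsto_setIntegral_inter_ball_one (f : A1) :
    Tendsto (fun n : ℕ => ∫ z in disc ∩ Metric.ball 1 (1 / ((n : ℝ) + 1)), ‖f z‖) atTop (𝓝 0) := by
  have hanti : Antitone fun n : ℕ => disc ∩ Metric.ball (1 : ℂ) (1 / ((n : ℝ) + 1)) := by
    intro m n hmn
    apply Set.inter_subset_inter_right
    apply Metric.ball_subset_ball
    gcongr
  have h := tendsto_setIntegral_of_antitone (μ := volume) (f := fun z => ‖f z‖)
    (fun n => measurableSet_disc.inter Metric.isOpen_ball.measurableSet) hanti
    ⟨0, f.integrable_norm.mono_set Set.inter_subset_left⟩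
  have hempty : ⋂ n : ℕ, disc ∩ Metric.ball (1 : ℂ) (1 / ((n : ℝ) + 1)) = ∅ := by
    rw [Set.eq_empty_iff_forall_notMem]
    intro z hz
    rw [Set.mem_iInter] at hz
    have hz1 : ‖z‖ < 1 := mem_disc.mp (hz 0).1
    have hd : 0 < dist z 1 := dist_pos.mpr fun h => by simp [h] at hz1
    obtain ⟨n, hn⟩ := exists_nat_one_div_lt hd
    exact lt_asymm hn (hz n).2
  rwa [hempty, setIntegral_empty] at h

theorem not_isCompactOperator_gammaOp [IsProbabilityMeasure μ] (h : GammaBounded μ)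
    (hμ : μ ≠ Measure.dirac 0) : ¬ IsCompactOperator (gammaOp μ h) := by
  intro hcomp
  set c := ∫ t : Set.Ico (0 : ℝ) 1, (t : ℝ) / 2 ∂μ with hc
  have hcpos : 0 < c := integral_pos_of_ne_dirac hμ
  -- The radius `4` bounds the normalised functions `(2 - a) f_a`, by `norm_testA1_le`.
  obtain ⟨K, hK, hKsub⟩ := hcomp.image_closedBall_subset_compact 4
  have hε : ∀ n : ℕ, 0 < 1 / ((n : ℝ) + 1) := fun n => by positivity
  have hε1 : ∀ n : ℕ, 1 / ((n : ℝ) + 1) ≤ 1 := fun n => by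
    rw [div_le_one (by positivity)]
    linarith [n.cast_nonneg (α := ℝ)]
  have ha : ∀ n : ℕ, 2 - 1 / ((n : ℝ) + 1) < 2 := fun n => by linarith [hε n]
  set f : ℕ → A1 := fun n => testA1 (2 - 1 / ((n : ℝ) + 1)) (ha n) with hf
  set g : ℕ → A1 := fun n => ((1 / ((n : ℝ) + 1) : ℝ) : ℂ) • f n with hg
  have hg4 : ∀ n, ‖g n‖ ≤ 4 := by
    intro n
    have h1 := norm_testA1_le (by linarith [hε1 n]) (ha n)
    rw [sub_sub_cancel, le_div_iff₀ (hε n), mul_comm] at h1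
    rw [hg, norm_smul, Complex.norm_real, Real.norm_of_nonneg (hε n).le]
    exact h1
  obtain ⟨G, -, ψ, hψ, hlim⟩ := hK.tendsto_subseq (x := fun n => gammaOp μ h (g n))
    fun n => hKsub ⟨g n, by simpa using hg4 n, rfl⟩
  have hnorm := tendsto_iff_norm_sub_tendsto_zero.mp hlim
  -- For fixed `δ` the lower bound `2c δ^(1/(n+1))` tends to `2c`, and norm convergence carries it
  -- to `G`; shrinking `δ` then gives the contradiction.
  have key : ∀ δ : ℝ, 0 < δ → δ ≤ 1 → 2 * c ≤ ∫ z in disc ∩ Metric.ball 1 δ, ‖G z‖ := by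
    intro δ hδ hδ1
    set S := disc ∩ Metric.ball (1 : ℂ) δ with hS
    have hSm : MeasurableSet S := measurableSet_disc.inter Metric.isOpen_ball.measurableSet
    have hSd : S ⊆ disc := Set.inter_subset_left
    have hlow : ∀ n : ℕ, c * (2 * δ ^ (1 / ((n : ℝ) + 1))) ≤ ∫ z in S, ‖gammaOp μ h (g n) z‖ := by
      intro n
      have h1 := le_setIntegral_norm_testA1 (ha n) hδ hδ1
      rw [sub_sub_cancel, div_le_iff₀ (hε n)] at h1
      have h2 : ∫ z in S, c * (1 / ((n : ℝ) + 1)) * ‖f n z‖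
          ≤ ∫ z in S, ‖gammaOp μ h (g n) z‖ := by
        refine setIntegral_mono_on (((f n).integrable_norm.mono_set hSd).const_mul _)
          ((gammaOp μ h (g n)).integrable_norm.mono_set hSd) hSm fun z hz => ?_
        have h3 := mul_norm_testA1_le_norm_gammaOp h (by linarith [hε1 n]) (ha n) (hSd hz)
        rw [hg, map_smul, A1.smul_apply, norm_mul, Complex.norm_real,
          Real.norm_of_nonneg (hε n).le, mul_comm c, mul_assoc]
        exact mul_le_mul_of_nonneg_left h3 (hε n).le
      rw [integral_const_mul] at h2
      refine le_trans ?_ h2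
      rw [mul_assoc, mul_comm (1 / ((n : ℝ) + 1))]
      exact mul_le_mul_of_nonneg_left h1 hcpos.le
    have hup : ∀ n, ∫ z in S, ‖gammaOp μ h (g n) z‖
        ≤ Real.pi * ‖gammaOp μ h (g n) - G‖ + ∫ z in S, ‖G z‖ := by
      intro n
      have hd := (gammaOp μ h (g n) - G).integrable_norm
      rw [← A1.setIntegral_norm]
      calc ∫ z in S, ‖gammaOp μ h (g n) z‖
          ≤ ∫ z in S, (‖(gammaOp μ h (g n) - G) z‖ + ‖G z‖) := by
            refine integral_mono ((gammaOp μ h (g n)).integrable_norm.mono_set hSd)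
              ((hd.mono_set hSd).add (G.integrable_norm.mono_set hSd)) fun z => ?_
            have := norm_add_le ((gammaOp μ h (g n) - G) z) (G z)
            rwa [← A1.add_apply, sub_add_cancel] at this
        _ = (∫ z in S, ‖(gammaOp μ h (g n) - G) z‖) + ∫ z in S, ‖G z‖ :=
            integral_add (hd.mono_set hSd) (G.integrable_norm.mono_set hSd)
        _ ≤ _ := by
            refine add_le_add_left ?_ _
            exact setIntegral_mono_set hd (ae_of_all _ fun _ => norm_nonneg _) hSd.eventuallyLE
    have hleft : Tendsto (fun n => c * (2 * δ ^ (1 / ((ψ n : ℝ) + 1)))) atTop (𝓝 (2 * c)) := by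
      have h1 := (tendsto_one_div_add_atTop_nhds_zero_nat (𝕜 := ℝ)).comp hψ.tendsto_atTop
      have h2 := ((Real.continuousAt_const_rpow hδ.ne').tendsto.comp h1).const_mul 2 |>.const_mul c
      rw [Real.rpow_zero, mul_one, mul_comm] at h2
      exact h2
    have hright : Tendsto (fun n => Real.pi * ‖gammaOp μ h (g (ψ n)) - G‖ + ∫ z in S, ‖G z‖)
        atTop (𝓝 (∫ z in S, ‖G z‖)) := by
      simpa using (hnorm.const_mul Real.pi).add_const (∫ z in S, ‖G z‖)
    exact le_of_tendsto_of_tendsto' hleft hright fun n => (hlow _).trans (hup _)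
  have := ge_of_tendsto' (tendsto_setIntegral_inter_ball_one G) fun n => key _ (hε n) (hε1 n)
  linarith

/-- The constant function one as an element of `A¹`. -/
noncomputable def oneA1 : A1 :=
  A1.mk (disc.indicator 1)
    ⟨(differentiableOn_const (1 : ℂ)).congr fun z hz => by simp [Set.indicator_of_mem hz],
      (integrable_indicator_iff measurableSet_disc).mpr
        (integrableOn_const (Metric.isBounded_ball.measure_lt_top.ne)) |>.integrableOn,
      fun z hz => Set.indicator_of_notMem hz _⟩

theorem oneA1_apply {z : ℂ} (hz : z ∈ disc) : oneA1 z = 1 := Set.indicator_of_mem hz _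

theorem isCompactOperator_gammaOp_of_eq_dirac (h : GammaBounded μ) (hμ : μ = Measure.dirac 0) :
    IsCompactOperator (gammaOp μ h) := by
  have h0 : (0 : ℂ) ∈ disc := by simp [mem_disc]
  have hdirac : ∀ (f : A1) {z : ℂ}, z ∈ disc → gammaOp μ h f z = f 0 * weight 0 z := by
    intro f z hz
    rw [gammaOp_apply h f hz, hμ, integral_dirac]
    simp [phi]
  have heq : (gammaOp μ h : A1 → A1) =
      ContinuousLinearMap.toSpanSingleton ℂ (gammaOp μ h oneA1) ∘ evalCLM 0 h0 := by
    funext f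
    ext z hz
    rw [Function.comp_apply, ContinuousLinearMap.toSpanSingleton_apply, A1.smul_apply, hdirac f hz,
      hdirac oneA1 hz, oneA1_apply h0, one_mul, evalCLM_apply]
  rw [heq]
  exact (isCompactOperator_of_locallyCompactSpace_dom (evalCLM 0 h0)).clm_comp
    (ContinuousLinearMap.toSpanSingleton ℂ (gammaOp μ h oneA1))

end BergmanHilbert

theorem theorem3 (μ : Measure (Set.Ico (0 : ℝ) 1)) [IsProbabilityMeasure μ]
    (h : BergmanHilbert.GammaBounded μ) :
    (IsCompactOperator (BergmanHilbert.gammaOp μ h) ↔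
      μ = Measure.dirac (0 : Set.Ico (0 : ℝ) 1)) ∧
    BergmanHilbert.CompletelyContinuous (BergmanHilbert.gammaOp μ h) :=
  ⟨⟨fun hcomp => by_contra fun hμ => BergmanHilbert.not_isCompactOperator_gammaOp h hμ hcomp,
    BergmanHilbert.isCompactOperator_gammaOp_of_eq_dirac h⟩,
    BergmanHilbert.completelyContinuous_of_A1 _⟩
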